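/- Let $d\ge 2$. Let $\mathbb R^{d,1}$ be $\mathbb R^{d+1}$ with the form $\langle x,y\rangle=x_1y_1+\dots+x_dy_d-x_{d+1}y_{d+1}$, let $\mathbb H^d=\{x : \langle x,x\rangle=-1,\ x_{d+1}>0\}$ be hyperbolic space, and let $O_+(d,1)$ be the group of linear maps that preserve the form and $\mathbb H^d$. Let $\Gamma\subset O_+(d,1)$ be a subgroup that acts freely and properly discontinuously on $\mathbb H^d$ with compact quotient, so that $\mathbb H^d/\Gamma$ is a compact hyperbolic manifold. Let $H^1(\Gamma,\mathbb R^{d,1})$ be the quotient of the space of cocycles, i.e. maps $\tau:\Gamma\to\mathbb R^{d,1}$ with $\tau(AB)=\tau(A)+A\,\tau(B)$, by the space of coboundaries $A\mapsto Av-v$, $v\in\mathbb R^{d,1}$. Suppose that $\mathbb H^d/\Gamma$ contains $n$ pairwise disjoint embedded totally geodesic hypersurfaces $H_1,\dots,H_n$, where a hypersurface is non-empty and closed (hence compact, without boundary); that is, the preimage of each $H_i$ in $\mathbb H^d$ coincides near each of its points with a totally geodesic hyperplane. Then $$\dim_{\mathbb R} H^1(\Gamma,\mathbb R^{d,1})\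 \ge\ n .$$ More precisely, fix any base point $x\in\mathbb H^d$ whose image in $\mathbb H^d/\Gamma$ lies on none of the $H_i$. A lift of $H_i$ is a totally geodesic hyperplane $l\subset\mathbb H^d$ contained in the preimage of $H_i$. For weights $\omega=(\omega_1,\dots,\omega_n)\in\mathbb R^n$ and $A\in\Gamma$ put $$\tau_\omega(A)=\sum_{i=1}^n\ \omega_i\sum_{l} v_l ,$$ where the inner (finite) sum runs over the lifts $l$ of $H_i$ that separate $x$ from $Ax$, equivalently those that are crossed by the geodesic from $x$ to $Ax$, and $v_l\in\mathbb R^{d,1}$ is the unit spacelike normal of $l$ pointing to the side of $Ax$. Then every $\tau_\omega$ is a cocycle, and the linear map $\omega\mapsto[\tau_\omega]$ from $\mathbb R^n$ to $H^1(\Gamma,\mathbb R^{d,1})$ is injective. -/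

import Mathlib

noncomputable section

namespace HypCocycle

/-- The vector space `ℝ^{d+1}` underlying Minkowski space `ℝ^{d,1}`. -/
abbrev Mink (d : ℕ) : Type := Fin (d + 1) → ℝ

/-- The Lorentzian form `x₁y₁ + ⋯ + x_d y_d - x_{d+1} y_{d+1}`. -/
def form {d : ℕ} (x y : Mink d) : ℝ :=
  (∑ i : Fin d, x i.castSucc * y i.castSucc) - x (Fin.last d) * y (Fin.last d)

/-- The hyperboloid `{x | ⟨x,x⟩ = -1, x_{d+1} > 0}`. -/
def hyperboloid (d : ℕ) : Set (Mink d) :=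
  {x | form x x = -1 ∧ 0 < x (Fin.last d)}

/-- Hyperbolic space `ℍ^d` in the hyperboloid model, with the topology induced by `ℝ^{d+1}`. -/
abbrev Hyp (d : ℕ) : Type := hyperboloid d

/-- The group `O₊(d,1)` of linear automorphisms of `ℝ^{d+1}` that preserve the Lorentzian form
and the hyperboloid; it is the isometry group of `ℍ^d`. -/
def OPlus (d : ℕ) : Subgroup (Mink d ≃ₗ[ℝ] Mink d) where
  carrier := {A | (∀ x y, form (A x) (A y) = form x y) ∧
    ∀ x, A x ∈ hyperboloid d ↔ x ∈ hyperboloid d}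
  mul_mem' := by
    rintro A B ⟨hA, hA'⟩ ⟨hB, hB'⟩
    refine ⟨fun x y => ?_, fun x => ?_⟩
    · rw [LinearEquiv.mul_apply, LinearEquiv.mul_apply, hA, hB]
    · rw [LinearEquiv.mul_apply, hA', hB']
  one_mem' := ⟨fun _ _ => rfl, fun _ => Iff.rfl⟩
  inv_mem' := by
    rintro A ⟨hA, hA'⟩
    have h : ∀ x, A (A⁻¹ x) = x := fun x => A.apply_symm_apply x
    refine ⟨fun x y => ?_, fun x => ?_⟩
    · rw [← hA, h, h]
    · rw [← hA', h]

/-- The isometric action of a subgroup of `O₊(d,1)` on `ℍ^d`. -/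
instance hypAction {d : ℕ} (Γ : Subgroup (OPlus d)) : MulAction Γ (Hyp d) where
  smul A x := ⟨A.1.1 x.1, (A.1.2.2 x.1).2 x.2⟩
  one_smul _ := rfl
  mul_smul _ _ _ := rfl

/-- The quotient `ℍ^d/Γ`, with the quotient topology. -/
abbrev HypQuotient {d : ℕ} (Γ : Subgroup (OPlus d)) : Type :=
  Quotient (MulAction.orbitRel Γ (Hyp d))

/-- The projection `ℍ^d → ℍ^d/Γ`. -/
def proj {d : ℕ} (Γ : Subgroup (OPlus d)) (x : Hyp d) : HypQuotient Γ :=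
  Quotient.mk _ x

/-- `ℍ^d/Γ` is a compact hyperbolic manifold: `Γ` acts freely and properly discontinuously on
`ℍ^d`, and the quotient is compact. -/
structure IsCompactHyperbolicManifold {d : ℕ} (Γ : Subgroup (OPlus d)) : Prop where
  free : ∀ (A : Γ) (x : Hyp d), A • x = x → A = 1
  properlyDiscontinuous : ProperlyDiscontinuousSMul Γ (Hyp d)
  compact : CompactSpace (HypQuotient Γ)

/-- The totally geodesic hyperplane of `ℍ^d` orthogonal to `v`, for a unit spacelike `v`. -/
def hyperplane {d : ℕ} (v : Mink d) : Set (Hyp d) :=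
  {x | form x.1 v = 0}

/-- `S` is a (non-empty, closed) embedded totally geodesic hypersurface of `ℍ^d/Γ`: it is a
closed subset and, in `ℍ^d`, which covers `ℍ^d/Γ` locally isometrically, it coincides near each of
its points with a totally geodesic hyperplane. It need be neither connected nor two-sided. -/
structure IsTotallyGeodesicHypersurface {d : ℕ} (Γ : Subgroup (OPlus d))
    (S : Set (HypQuotient Γ)) : Prop where
  nonempty : S.Nonempty
  isClosed : IsClosed S
  locally_hyperplane : ∀ x : Hyp d, proj Γ x ∈ S →
    ∃ v : Mink d, form v v = 1 ∧
      ∃ U : Set (Hyp d), IsOpen U ∧ x ∈ U ∧ proj Γ ⁻¹' S ∩ U = hyperplane v ∩ U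

/-- The unit spacelike vectors `v` such that `hyperplane v` is a lift of (a component of) `S`
that separates `x` from `y`, and `v` is its unit normal pointing to the side of `y`. Every
separating lift has exactly one such `v`. A geodesic from `x` to `y`, neither of which
is on a lift, crosses exactly the separating lifts, each of them once and transversally. -/
def crossedNormals {d : ℕ} (Γ : Subgroup (OPlus d)) (S : Set (HypQuotient Γ)) (x y : Hyp d) :
    Set (Mink d) :=
  {v | form v v = 1 ∧ hyperplane v ⊆ proj Γ ⁻¹' S ∧ form x.1 v < 0 ∧ 0 < form y.1 v}

/-- The sum of the unit normals, in the direction of travel, of the lifts of `S` that are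
crossed on the way from `x` to `y`. -/
def crossing {d : ℕ} (Γ : Subgroup (OPlus d)) (S : Set (HypQuotient Γ)) (x y : Hyp d) : Mink d :=
  ∑ᶠ v ∈ crossedNormals Γ S x y, v

/-- The standard linear representation of `Γ` on `ℝ^{d,1}`. -/
def minkRepresentation {d : ℕ} (Γ : Subgroup (OPlus d)) : Representation ℝ Γ (Mink d) where
  toFun A := (A.1.1 : Mink d →ₗ[ℝ] Mink d)
  map_one' := rfl
  map_mul' _ _ := rfl

/-- The `Γ`-module `ℝ^{d,1}`. -/
abbrev minkRep {d : ℕ} (Γ : Subgroup (OPlus d)) : Rep ℝ Γ :=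
  Rep.of (minkRepresentation Γ)

end HypCocycle

end

/-!
Across a wall with unit normal `v` of weight `a`, let a map `g : ℍ^d → ℝ^{d,1}` jump by `a • v`,
taking the mean value on the wall, and let it be constant elsewhere. Such a `g` is determined up to
a constant, and the crossing cocycle is a coboundary exactly if `g` can be chosen `Γ`-equivariant.
In that case the potential `P y = ⟨y, g y⟩` is `Γ`-invariant, and it is continuous because the jump
of `g` at a wall is orthogonal to the wall, so `P` attains its maximum at some `y`. As `d ≥ 2` and
the walls are disjoint, there is a geodesic through `y` that crosses no wall near `y`. Along it `g`
is constant near `y`, and `P (γ s) + P (γ (-s)) = 2 * cosh s * P y`, hence `P y ≤ 0` by maximality.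
The same argument for `-g` gives `P = 0`. But along a geodesic orthogonal to the wall, this sum has
the additional term `a * |sinh s|`, so `a = 0`.
-/

namespace HypCocycle

open Filter Function Topology

variable {d : ℕ}

section Form

lemma form_comm (x y : Mink d) : form x y = form y x := by
  simp only [form, mul_comm]

lemma form_add_left (x y z : Mink d) : form (x + y) z = form x z + form y z := by
  simp only [form, Pi.add_apply, add_mul, Finset.sum_add_distrib]
  ring

lemma form_smul_left (a : ℝ) (x z : Mink d) : form (a • x) z = a * form x z := by
  simp only [form, Pi.smul_apply, smul_eq_mul, mul_assoc, ← Finset.mul_sum]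
  ring

/-- The Lorentzian form `form` as a bilinear form, which gives access to the library on bilinear
maps. -/
noncomputable def formBilin (d : ℕ) : LinearMap.BilinForm ℝ (Mink d) :=
  LinearMap.mk₂ ℝ form form_add_left form_smul_left
    (fun x y z => by rw [form_comm, form_add_left, form_comm y, form_comm z])
    (fun a x y => by rw [form_comm, form_smul_left, form_comm y, smul_eq_mul])

@[simp] lemma formBilin_apply (x y : Mink d) : formBilin d x y = form x y := rfl

lemma form_add_right (x y z : Mink d) : form x (y + z) = form x y + form x z :=
  (formBilin d x).map_add y z

lemma form_smul_right (a : ℝ) (x y : Mink d) : form x (a • y) = a * form x y :=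
  (formBilin d x).map_smul a y

lemma form_neg_left (x y : Mink d) : form (-x) y = -form x y :=
  (formBilin d).map_neg₂ x y

lemma form_neg_right (x y : Mink d) : form x (-y) = -form x y :=
  (formBilin d x).map_neg y

lemma form_sub_left (x y z : Mink d) : form (x - y) z = form x z - form y z :=
  (formBilin d).map_sub₂ x y z

@[fun_prop]
lemma continuous_form {X : Type*} [TopologicalSpace X] {f g : X → Mink d}
    (hf : Continuous f) (hg : Continuous g) : Continuous fun a => form (f a) (g a) := by
  unfold HypCocycle.form
  fun_prop

/-- The open cone of future-directed timelike vectors. It is the cone over `hyperboloid d`. -/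
def futureCone (d : ℕ) : Set (Mink d) := {z | form z z < 0 ∧ 0 < z (Fin.last d)}

lemma form_neg_of_mem_futureCone {y z : Mink d} (hy : y ∈ futureCone d) (hz : z ∈ futureCone d) :
    form y z < 0 := by
  obtain ⟨hy, hy'⟩ := hy
  obtain ⟨hz, hz'⟩ := hz
  have cauchy_schwarz := Finset.sum_mul_sq_le_sq_mul_sq Finset.univ
    (fun i : Fin d => y i.castSucc) (fun i => z i.castSucc)
  simp only [form, ← sq] at hy hz ⊢
  have hz_nonneg : 0 ≤ ∑ i : Fin d, z i.castSucc ^ 2 := Finset.sum_nonneg fun _ _ => sq_nonneg _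
  have hlt : (∑ i : Fin d, y i.castSucc * z i.castSucc) < y (Fin.last d) * z (Fin.last d) := by
    refine lt_of_pow_lt_pow_left₀ 2 (by positivity) ?_
    have : 0 < y (Fin.last d) ^ 2 := by positivity
    nlinarith
  linarith

lemma smul_mem_futureCone {a : ℝ} (ha : 0 < a) {z : Mink d} (hz : z ∈ futureCone d) :
    a • z ∈ futureCone d := by
  refine ⟨?_, mul_pos ha hz.2⟩
  rw [form_smul_left, form_smul_right]
  exact mul_neg_of_pos_of_neg ha (mul_neg_of_pos_of_neg ha hz.1)

lemma add_mem_futureCone {y z : Mink d} (hy : y ∈ futureCone d) (hz : z ∈ futureCone d) :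
    y + z ∈ futureCone d := by
  refine ⟨?_, add_pos hy.2 hz.2⟩
  have h := form_neg_of_mem_futureCone hy hz
  rw [form_add_left, form_add_right, form_add_right, form_comm z y]
  linarith [hy.1, hz.1]

lemma convex_futureCone : Convex ℝ (futureCone d) :=
  convex_iff_forall_pos.2 fun _ hy _ hz _ _ ha hb _ =>
    add_mem_futureCone (smul_mem_futureCone ha hy) (smul_mem_futureCone hb hz)

lemma mem_futureCone_of_form_neg {y z : Mink d} (hy : y ∈ futureCone d) (hz : form z z < 0)
    (hzy : form z y < 0) : z ∈ futureCone d := by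
  refine ⟨hz, ?_⟩
  by_contra! hlast
  rcases hlast.lt_or_eq with hlast | hlast
  · have hneg : -z ∈ futureCone d := ⟨by simpa [form_neg_left, form_neg_right] using hz, by simpa⟩
    have := form_neg_of_mem_futureCone hneg hy
    rw [form_neg_left] at this
    linarith
  · have : 0 ≤ ∑ i : Fin d, z i.castSucc * z i.castSucc :=
      Finset.sum_nonneg fun _ _ => mul_self_nonneg _
    simp only [form, hlast] at hz
    linarith

lemma form_self_pos_of_form_eq_zero {y q : Mink d} (hy : form y y < 0) (hqy : form q y = 0)
    (hq : q ≠ 0) : 0 < form q q := by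
  contrapose! hq
  have cauchy_schwarz := Finset.sum_mul_sq_le_sq_mul_sq Finset.univ
    (fun i : Fin d => q i.castSucc) (fun i => y i.castSucc)
  simp only [form, ← sq] at hy hqy hq
  rw [sub_eq_zero.1 hqy] at cauchy_schwarz
  have hy_nonneg : 0 ≤ ∑ i : Fin d, y i.castSucc ^ 2 := Finset.sum_nonneg fun _ _ => sq_nonneg _
  have hq_nonneg : 0 ≤ ∑ i : Fin d, q i.castSucc ^ 2 := Finset.sum_nonneg fun _ _ => sq_nonneg _
  have hlast : q (Fin.last d) = 0 := by
    by_contra h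
    have : 0 < q (Fin.last d) ^ 2 := by positivity
    nlinarith
  have hsum : ∑ i : Fin d, q i.castSucc ^ 2 = 0 :=
    le_antisymm (by rw [hlast] at hq; linarith) hq_nonneg
  rw [Finset.sum_eq_zero_iff_of_nonneg fun _ _ => sq_nonneg _] at hsum
  exact funext <| Fin.lastCases hlast fun i => by simpa using hsum i (Finset.mem_univ _)

end Form

section Segments

lemma Hyp.form_self (y : Hyp d) : form y.1 y.1 = -1 := y.2.1

lemma Hyp.mem_futureCone (y : Hyp d) : y.1 ∈ futureCone d :=
  ⟨by rw [y.form_self]; norm_num, y.2.2⟩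

lemma sqrt_neg_form_self_pos (z : futureCone d) : 0 < √(-form z.1 z.1) :=
  Real.sqrt_pos.2 (neg_pos.2 z.2.1)

/-- The radial projection of the future cone to hyperbolic space. -/
noncomputable def toHyp (z : futureCone d) : Hyp d :=
  ⟨(√(-form z.1 z.1))⁻¹ • z.1, by
    have hsqrt := sqrt_neg_form_self_pos z
    refine ⟨?_, mul_pos (inv_pos.2 hsqrt) z.2.2⟩
    have hsq : √(-form z.1 z.1) * √(-form z.1 z.1) = -form z.1 z.1 :=
      Real.mul_self_sqrt (neg_nonneg.2 z.2.1.le)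
    rw [form_smul_left, form_smul_right]
    field_simp
    linarith⟩

lemma continuous_toHyp : Continuous (toHyp (d := d)) := by
  refine Continuous.subtype_mk ?_ _
  have h : Continuous fun z : futureCone d => √(-form z.1 z.1) := by fun_prop
  exact (h.inv₀ fun z => (sqrt_neg_form_self_pos z).ne').smul continuous_subtype_val

lemma toHyp_coe (y : Hyp d) : toHyp ⟨y.1, y.mem_futureCone⟩ = y :=
  Subtype.ext (by simp [toHyp, y.form_self])

lemma form_toHyp_eq_zero_iff (z : futureCone d) (v : Mink d) :
    form (toHyp z).1 v = 0 ↔ form z.1 v = 0 := by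
  simp [toHyp, form_smul_left, (sqrt_neg_form_self_pos z).ne']

/-- The geodesic segment from `y` to `z`, parametrized by the radial projection of the straight
segment, so not by arc length. -/
noncomputable def segPoint (y z : Hyp d) (t : unitInterval) : Hyp d :=
  toHyp ⟨(1 - t : ℝ) • y.1 + (t : ℝ) • z.1,
    convex_futureCone y.mem_futureCone z.mem_futureCone (sub_nonneg.2 t.2.2) t.2.1 (by ring)⟩

lemma continuous_segPoint (y : Hyp d) : Continuous (uncurry (segPoint y)) :=
  continuous_toHyp.comp (Continuous.subtype_mk (by fun_prop) _)

lemma continuous_segPoint_right (y z : Hyp d) : Continuous (segPoint y z) :=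
  (continuous_segPoint y).uncurry_left z

@[simp] lemma segPoint_zero (y z : Hyp d) : segPoint y z 0 = y := by
  simp [segPoint, toHyp_coe]

@[simp] lemma segPoint_one (y z : Hyp d) : segPoint y z 1 = z := by
  simp [segPoint, toHyp_coe]

@[simp] lemma segPoint_self (y : Hyp d) (t : unitInterval) : segPoint y y t = y := by
  simp [segPoint, ← add_smul, toHyp_coe]

lemma mem_hyperplane {v : Mink d} {y : Hyp d} : y ∈ hyperplane v ↔ form y.1 v = 0 := Iff.rfl

@[simp] lemma hyperplane_neg (v : Mink d) : hyperplane (-v) = hyperplane v := by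
  ext
  simp [mem_hyperplane, form_neg_right]

lemma isClosed_hyperplane (v : Mink d) : IsClosed (hyperplane v) :=
  isClosed_eq (f := fun y : Hyp d => form y.1 v) (by fun_prop) continuous_const

lemma segPoint_mem_hyperplane {v : Mink d} {y z : Hyp d} (hy : y ∈ hyperplane v)
    (hz : z ∈ hyperplane v) (t : unitInterval) : segPoint y z t ∈ hyperplane v := by
  rw [mem_hyperplane] at hy hz
  rw [mem_hyperplane, segPoint, form_toHyp_eq_zero_iff, form_add_left, form_smul_left,
    form_smul_left, hy, hz, mul_zero, mul_zero, add_zero]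

lemma isPreconnected_hyperplane (v : Mink d) : IsPreconnected (hyperplane v) :=
  isPreconnected_of_forall_pair fun y hy z hz =>
    ⟨Set.range (segPoint y z), Set.range_subset_iff.2 (segPoint_mem_hyperplane hy hz),
      ⟨0, by simp⟩, ⟨1, by simp⟩, isPreconnected_range (continuous_segPoint_right y z)⟩

/-- The side of `hyperplane v` on which `y` lies: `1` on the side to which `v` points, `-1` on the
other side, and `0` on the hyperplane. -/
noncomputable def side (v : Mink d) (y : Hyp d) : SignType := SignType.sign (form y.1 v)

lemma side_eq_zero_iff {v : Mink d} {y : Hyp d} : side v y = 0 ↔ y ∈ hyperplane v :=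
  sign_eq_zero_iff

lemma form_mul_side (v : Mink d) (y : Hyp d) : form y.1 v * side v y = |form y.1 v| :=
  self_mul_sign _

lemma exists_segPoint_mem_hyperplane {v : Mink d} {y z : Hyp d} (h : side v y ≠ side v z) :
    ∃ t, segPoint y z t ∈ hyperplane v := by
  have hcont : Continuous fun t => form (segPoint y z t).1 v :=
    continuous_form (continuous_subtype_val.comp (continuous_segPoint_right y z)) continuous_const
  refine mem_range_of_exists_le_of_exists_ge hcont ?_ ?_
  · by_contra! hpos
    exact h ((sign_pos (by simpa using hpos 0)).trans (sign_pos (by simpa using hpos 1)).symm)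
  · by_contra! hneg
    exact h ((sign_neg (by simpa using hneg 0)).trans (sign_neg (by simpa using hneg 1)).symm)

end Segments

section Geodesics

variable {y : Hyp d} {q v : Mink d}

/-- The unit speed geodesic through the point `y` of hyperbolic space with velocity `q`, a unit
tangent vector at `y`. -/
noncomputable def geodesic (hq : form q q = 1) (hqy : form q y.1 = 0) (s : ℝ) : Hyp d :=
  ⟨Real.cosh s • y.1 + Real.sinh s • q, by
    have hself : form (Real.cosh s • y.1 + Real.sinh s • q) (Real.cosh s • y.1 + Real.sinh s • q)
        = -1 := by
      simp only [form_add_left, form_add_right, form_smul_left, form_smul_right, y.form_self, hq,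
        hqy, form_comm y.1 q]
      linarith [Real.cosh_sq s]
    have hy : form (Real.cosh s • y.1 + Real.sinh s • q) y.1 < 0 := by
      rw [form_add_left, form_smul_left, form_smul_left, y.form_self, hqy]
      linarith [Real.cosh_pos s]
    exact ⟨hself, (mem_futureCone_of_form_neg y.mem_futureCone (by rw [hself]; norm_num) hy).2⟩⟩

lemma form_geodesic (hq : form q q = 1) (hqy : form q y.1 = 0) (s : ℝ) (v : Mink d) :
    form (geodesic hq hqy s).1 v = Real.cosh s * form y.1 v + Real.sinh s * form q v := by
  rw [geodesic, form_add_left, form_smul_left, form_smul_left]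

lemma form_geodesic_of_mem_hyperplane (hq : form q q = 1) (hqy : form q y.1 = 0) (s : ℝ)
    (hy : y ∈ hyperplane v) : form (geodesic hq hqy s).1 v = Real.sinh s * form q v := by
  rw [form_geodesic, mem_hyperplane.1 hy, mul_zero, zero_add]

lemma tendsto_geodesic (hq : form q q = 1) (hqy : form q y.1 = 0) :
    Tendsto (geodesic hq hqy) (𝓝 0) (𝓝 y) := by
  have hcont : Continuous (geodesic hq hqy) := Continuous.subtype_mk (by fun_prop) _
  have h0 : geodesic hq hqy 0 = y := Subtype.ext (by simp [geodesic])
  simpa only [h0] using hcont.tendsto 0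

lemma exists_smul_unit (y : Hyp d) (hq : q ≠ 0) (hqy : form q y.1 = 0) :
    ∃ r : ℝ, r ≠ 0 ∧ form (r • q) (r • q) = 1 := by
  have hpos := form_self_pos_of_form_eq_zero y.mem_futureCone.1 hqy hq
  refine ⟨(√(form q q))⁻¹, (inv_pos.2 (Real.sqrt_pos.2 hpos)).ne', ?_⟩
  rw [form_smul_left, form_smul_right, ← mul_assoc, ← mul_inv, Real.mul_self_sqrt hpos.le,
    inv_mul_cancel₀ hpos.ne']

lemma exists_ne_zero_form_eq_zero (hd : 2 ≤ d) (y v : Mink d) :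
    ∃ q : Mink d, q ≠ 0 ∧ form q y = 0 ∧ form q v = 0 := by
  let f : Mink d →ₗ[ℝ] ℝ × ℝ := (formBilin d y).prod (formBilin d v)
  have hker : LinearMap.ker f ≠ ⊥ := LinearMap.ker_ne_bot_of_finrank_lt (by simp; omega)
  obtain ⟨q, hq, hq0⟩ := Submodule.exists_mem_ne_zero_of_ne_bot hker
  have : form y q = 0 ∧ form v q = 0 := by simpa [f] using hq
  exact ⟨q, hq0, by rw [form_comm, this.1], by rw [form_comm, this.2]⟩

lemma exists_unit_form_eq_zero (hd : 2 ≤ d) (y : Hyp d) (v : Mink d) :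
    ∃ q : Mink d, form q q = 1 ∧ form q y.1 = 0 ∧ form q v = 0 := by
  obtain ⟨q, hq, hqy, hqv⟩ := exists_ne_zero_form_eq_zero hd y.1 v
  obtain ⟨r, -, hr⟩ := exists_smul_unit y hq hqy
  exact ⟨r • q, hr, by rw [form_smul_left, hqy, mul_zero], by rw [form_smul_left, hqv, mul_zero]⟩

lemma form_eq_zero_of_eventually_mem_hyperplane {u : Mink d} (hyv : y ∈ hyperplane v)
    (h : ∀ᶠ z in 𝓝 y, z ∈ hyperplane v → z ∈ hyperplane u) (hqy : form q y.1 = 0)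
    (hqv : form q v = 0) : form q u = 0 := by
  rcases eq_or_ne q 0 with rfl | hq0
  · exact (formBilin d).map_zero₂ u
  obtain ⟨r, hr, hq⟩ := exists_smul_unit y hq0 hqy
  have hrqy : form (r • q) y.1 = 0 := by rw [form_smul_left, hqy, mul_zero]
  obtain ⟨s, hs, hsu⟩ := ((tendsto_geodesic hq hrqy).eventually h).exists_gt
  have hsv : geodesic hq hrqy s ∈ hyperplane v := by
    rw [mem_hyperplane, form_geodesic_of_mem_hyperplane hq hrqy s hyv, form_smul_left, hqv,
      mul_zero, mul_zero]
  have := mem_hyperplane.1 (hsu hsv)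
  rw [form_geodesic_of_mem_hyperplane hq hrqy s (h.self_of_nhds hyv), form_smul_left] at this
  simpa [hr, hs.ne'] using this

lemma eq_or_eq_neg_of_eventually_mem_hyperplane {u : Mink d} (hu : form u u = 1)
    (hv : form v v = 1) (hyv : y ∈ hyperplane v)
    (h : ∀ᶠ z in 𝓝 y, z ∈ hyperplane v → z ∈ hyperplane u) : u = v ∨ u = -v := by
  have hyu : y ∈ hyperplane u := h.self_of_nhds hyv
  have hqy : form (u - form u v • v) y.1 = 0 := by
    rw [form_sub_left, form_smul_left, form_comm u y.1, form_comm v y.1, mem_hyperplane.1 hyv,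
      mem_hyperplane.1 hyu, mul_zero, sub_zero]
  have hqv : form (u - form u v • v) v = 0 := by
    rw [form_sub_left, form_smul_left, hv, mul_one, sub_self]
  have hqu := form_eq_zero_of_eventually_mem_hyperplane hyv h hqy hqv
  have hq : u = form u v • v := by
    by_contra hne
    refine (form_self_pos_of_form_eq_zero y.mem_futureCone.1 hqy (sub_ne_zero.2 hne)).ne' ?_
    rw [form_comm, form_sub_left, form_smul_left, form_comm u, form_comm v, hqu, hqv, mul_zero,
      sub_zero]
  have hsq : form u v * form u v = 1 := by
    nth_rw 2 [hq] at hu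
    rwa [form_smul_right] at hu
  exact (mul_self_eq_one_iff.1 hsq).imp (fun h => by rw [hq, h, one_smul])
    fun h => by rw [hq, h, neg_one_smul]

end Geodesics

section Weights

variable {c : Mink d → ℝ} {y : Hyp d} {q v : Mink d}

/-- A weight `c` assigns the number `c v` to the hyperplane with normal `v`, its walls being the
hyperplanes of non-zero weight. This says that only finitely many walls come close to any given
point. -/
def HasLocallyFiniteWalls (c : Mink d → ℝ) : Prop :=
  LocallyFinite fun v : support c => hyperplane (v : Mink d)

/-- Walls of `c` that meet are equal, up to the orientation of their normals. -/
def HasDisjointWalls (c : Mink d → ℝ) : Prop :=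
  ∀ u ∈ support c, ∀ v ∈ support c, ∀ y ∈ hyperplane u, y ∈ hyperplane v → u = v ∨ u = -v

/-- The normals of the walls of `c` through `y`. -/
def wallsThrough (c : Mink d → ℝ) (y : Hyp d) : Set (Mink d) :=
  {v | v ∈ support c ∧ y ∈ hyperplane v}

/-- The sum of the weighted normals, in the direction of travel, of the walls that are crossed on
the way from `x` to `y`. A wall counts for both of its normals, and `side` jumps by `2` across it,
hence the factor `1 / 4`; a wall through an end point counts by half, which makes the sum additive
without any assumption on the position of the points. -/
noncomputable def signedCrossing (c : Mink d → ℝ) (x y : Hyp d) : Mink d :=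
  (1 / 4 : ℝ) • ∑ᶠ v, (c v * (side v y - side v x)) • v

/-- Four times the difference, at points `z` near `y`, between `⟨z, g z⟩` and `⟨z, g y⟩`, where `g`
jumps by the weighted normals across the walls (see `IsPrimitive.eventually_potential_eq`). -/
noncomputable def bending (c : Mink d → ℝ) (y : Hyp d) (z : Mink d) : ℝ :=
  ∑ᶠ v ∈ wallsThrough c y, c v * |form z v|

lemma HasLocallyFiniteWalls.mono {c' : Mink d → ℝ} (hc : HasLocallyFiniteWalls c)
    (h : support c' ⊆ support c) : HasLocallyFiniteWalls c' :=
  (hc.comp_injective (Set.inclusion_injective h) :)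

lemma HasLocallyFiniteWalls.neg (hc : HasLocallyFiniteWalls c) : HasLocallyFiniteWalls (-c) :=
  hc.mono (support_neg c).le

lemma HasDisjointWalls.neg (hdisj : HasDisjointWalls c) : HasDisjointWalls (-c) := by
  simpa only [HasDisjointWalls, support_neg] using hdisj

lemma HasLocallyFiniteWalls.finite_wallsThrough (hc : HasLocallyFiniteWalls c) (y : Hyp d) :
    (wallsThrough c y).Finite :=
  ((hc.point_finite y).image Subtype.val).subset fun v hv => ⟨⟨v, hv.1⟩, hv.2, rfl⟩

lemma HasLocallyFiniteWalls.finite_side_ne (hc : HasLocallyFiniteWalls c) (x y : Hyp d) :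
    {v | v ∈ support c ∧ side v x ≠ side v y}.Finite := by
  have hK : IsCompact (Set.range (segPoint x y)) := isCompact_range (continuous_segPoint_right x y)
  refine ((hc.finite_nonempty_inter_compact hK).image Subtype.val).subset fun v hv => ?_
  obtain ⟨t, ht⟩ := exists_segPoint_mem_hyperplane hv.2
  exact ⟨⟨v, hv.1⟩, ⟨_, ht, t, rfl⟩, rfl⟩

lemma HasLocallyFiniteWalls.eventually_side_eq (hc : HasLocallyFiniteWalls c) (y : Hyp d) :
    ∀ᶠ z in 𝓝 y, ∀ v ∈ support c, y ∉ hyperplane v → side v z = side v y := by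
  have hnear := hc.iInter_compl_mem_nhds (fun v => isClosed_hyperplane v.1) y
  have hseg : ∀ᶠ z in 𝓝 y, ∀ t ∈ Set.univ,
      segPoint y z t ∈ ⋂ v : support c, ⋂ _ : y ∉ hyperplane v.1, (hyperplane v.1)ᶜ := by
    refine isCompact_univ.eventually_forall_of_forall_eventually fun t _ => ?_
    refine (continuous_segPoint y).continuousAt.eventually_mem ?_
    simpa only [uncurry, segPoint_self] using hnear
  filter_upwards [hseg] with z hz v hv hyv
  by_contra hne
  obtain ⟨t, ht⟩ := exists_segPoint_mem_hyperplane (Ne.symm hne)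
  exact Set.mem_iInter₂.1 (hz t trivial) ⟨v, hv⟩ hyv ht

lemma HasLocallyFiniteWalls.hasFiniteSupport (hc : HasLocallyFiniteWalls c) (x y : Hyp d) :
    HasFiniteSupport fun v => (c v * ((side v y : ℝ) - side v x)) • v := by
  refine (hc.finite_side_ne x y).subset fun v hv => ⟨fun h => hv ?_, fun h => hv ?_⟩ <;> simp [h]

lemma signedCrossing_neg (c : Mink d → ℝ) (x y : Hyp d) :
    signedCrossing (-c) x y = -signedCrossing c x y := by
  simp only [signedCrossing, Pi.neg_apply, neg_mul, neg_smul, finsum_neg_distrib, smul_neg]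

lemma HasLocallyFiniteWalls.signedCrossing_add (hc : HasLocallyFiniteWalls c) (x y z : Hyp d) :
    signedCrossing c x y + signedCrossing c y z = signedCrossing c x z := by
  rw [signedCrossing, signedCrossing, ← smul_add,
    ← finsum_add_distrib (hc.hasFiniteSupport x y) (hc.hasFiniteSupport y z), signedCrossing]
  simp only [← add_smul, ← mul_add, sub_add_sub_cancel']

lemma signedCrossing_sum_smul {ι : Type*} (s : Finset ι) (ω : ι → ℝ) {c : ι → Mink d → ℝ}
    (hc : ∀ i ∈ s, HasLocallyFiniteWalls (c i)) (x y : Hyp d) :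
    signedCrossing (∑ i ∈ s, ω i • c i) x y = ∑ i ∈ s, ω i • signedCrossing (c i) x y := by
  simp only [signedCrossing, smul_comm (ω _), ← Finset.smul_sum]
  congr 1
  simp only [Finset.sum_apply, Pi.smul_apply, Finset.sum_mul, Finset.sum_smul, smul_eq_mul,
    mul_assoc, mul_smul (ω _), smul_finsum]
  refine finsum_sum_comm s _ fun i hi => ?_
  exact ((hc i hi).hasFiniteSupport x y).subset fun v => by simp +contextual

lemma HasLocallyFiniteWalls.form_signedCrossing (hc : HasLocallyFiniteWalls c) (q : Mink d)
    (x y : Hyp d) : form q (signedCrossing c x y) =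
      (1 / 4) * ∑ᶠ v, c v * ((side v y : ℝ) - side v x) * form q v := by
  rw [signedCrossing, form_smul_right, ← formBilin_apply,
    map_finsum (formBilin d q) (hc.hasFiniteSupport x y)]
  simp only [formBilin_apply, form_smul_right]

lemma HasLocallyFiniteWalls.eventually_form_signedCrossing (hc : HasLocallyFiniteWalls c)
    (y : Hyp d) :
    ∀ᶠ z in 𝓝 y, form z.1 (signedCrossing c y z) = (1 / 4) * bending c y z.1 := by
  filter_upwards [hc.eventually_side_eq y] with z hz
  classical
  rw [hc.form_signedCrossing, bending]
  congr 1
  refine finsum_congr fun v => ?_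
  by_cases hv : v ∈ wallsThrough c y
  · rw [finsum_eq_if, if_pos hv, side_eq_zero_iff.2 hv.2, SignType.coe_zero, sub_zero, mul_assoc,
      mul_comm (side v z : ℝ), form_mul_side]
  · rw [finsum_eq_if, if_neg hv]
    by_cases hcv : c v = 0
    · simp [hcv]
    · simp [hz v hcv fun hyv => hv ⟨hcv, hyv⟩]

lemma HasLocallyFiniteWalls.continuous_bending (hc : HasLocallyFiniteWalls c) (y : Hyp d) :
    Continuous (bending c y) := by
  have h : bending c y = fun z => ∑ v ∈ (hc.finite_wallsThrough y).toFinset, c v * |form z v| :=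
    funext fun z => finsum_mem_eq_finite_toFinset_sum _ _
  rw [h]
  fun_prop

lemma bending_eq_zero (h : ∀ v ∈ wallsThrough c y, form q v = 0) : bending c y q = 0 :=
  finsum_mem_eq_zero_of_forall_eq_zero fun v hv => by rw [h v hv, abs_zero, mul_zero]

lemma bending_geodesic (hq : form q q = 1) (hqy : form q y.1 = 0) (s : ℝ) :
    bending c y (geodesic hq hqy s).1 = |Real.sinh s| * bending c y q := by
  rw [bending, bending, mul_finsum_mem]
  refine finsum_mem_congr rfl fun v hv => ?_
  rw [form_geodesic_of_mem_hyperplane hq hqy s hv.2, abs_mul, mul_left_comm]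

lemma HasDisjointWalls.wallsThrough_eq (hdisj : HasDisjointWalls c) (heven : c.Even)
    (hv : v ∈ wallsThrough c y) : wallsThrough c y = {v, -v} := by
  refine Set.Subset.antisymm (fun u hu => hdisj u hu.1 v hv.1 y hu.2 hv.2) ?_
  rintro u (rfl | rfl)
  · exact hv
  · exact ⟨by rw [mem_support, heven]; exact hv.1, by rw [hyperplane_neg]; exact hv.2⟩

lemma HasDisjointWalls.bending_normal (hdisj : HasDisjointWalls c) (heven : c.Even)
    (hv : form v v = 1) (hvy : v ∈ wallsThrough c y) : bending c y v = 2 * c v := by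
  have hne : v ≠ -v := fun h => by simp [self_eq_neg.1 h, form] at hv
  rw [bending, hdisj.wallsThrough_eq heven hvy, finsum_mem_pair hne, form_neg_right, abs_neg, hv,
    heven, abs_one]
  ring

lemma HasDisjointWalls.exists_unit_tangent (hdisj : HasDisjointWalls c) (hd : 2 ≤ d) (y : Hyp d) :
    ∃ q : Mink d, form q q = 1 ∧ form q y.1 = 0 ∧ ∀ v ∈ wallsThrough c y, form q v = 0 := by
  rcases (wallsThrough c y).eq_empty_or_nonempty with hempty | ⟨u, hu⟩
  · obtain ⟨q, hq, hqy, -⟩ := exists_unit_form_eq_zero hd y 0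
    exact ⟨q, hq, hqy, by simp [hempty]⟩
  · obtain ⟨q, hq, hqy, hqu⟩ := exists_unit_form_eq_zero hd y u
    refine ⟨q, hq, hqy, fun v hv => ?_⟩
    rcases hdisj v hv.1 u hu.1 y hv.2 hu.2 with rfl | rfl
    · exact hqu
    · rw [form_neg_right, hqu, neg_zero]

end Weights

section Potential

variable {c : Mink d → ℝ} {g : Hyp d → Mink d} {y : Hyp d} {q : Mink d}

/-- `g` jumps across each wall of `c` by the weighted normal of the wall, takes the mean value on
the wall, and is constant elsewhere. -/
def IsPrimitive (c : Mink d → ℝ) (g : Hyp d → Mink d) : Prop :=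
  ∀ y z, g z = g y + signedCrossing c y z

/-- The function `y ↦ ⟨y, g y⟩` on hyperbolic space. -/
noncomputable def potential (g : Hyp d → Mink d) (y : Hyp d) : ℝ := form y.1 (g y)

lemma potential_neg (g : Hyp d → Mink d) (y : Hyp d) : potential (-g) y = -potential g y :=
  form_neg_right _ _

lemma IsPrimitive.neg (hg : IsPrimitive c g) : IsPrimitive (-c) (-g) := fun y z => by
  rw [Pi.neg_apply, hg y z, signedCrossing_neg, neg_add, Pi.neg_apply]

lemma IsPrimitive.eventually_potential_eq (hg : IsPrimitive c g) (hc : HasLocallyFiniteWalls c)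
    (y : Hyp d) :
    ∀ᶠ z in 𝓝 y, potential g z = form z.1 (g y) + (1 / 4) * bending c y z.1 := by
  filter_upwards [hc.eventually_form_signedCrossing y] with z hz
  rw [potential, hg y z, form_add_right, hz]

lemma IsPrimitive.continuous_potential (hg : IsPrimitive c g) (hc : HasLocallyFiniteWalls c) :
    Continuous (potential g) := by
  refine continuous_iff_continuousAt.2 fun y => ?_
  have hbending : Continuous fun z : Hyp d => bending c y z.1 :=
    (hc.continuous_bending y).comp continuous_subtype_val
  have h : Continuous fun z : Hyp d => form z.1 (g y) + (1 / 4) * bending c y z.1 := by fun_prop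
  exact h.continuousAt.congr (EventuallyEq.symm (hg.eventually_potential_eq hc y))

lemma IsPrimitive.eventually_potential_geodesic_add (hg : IsPrimitive c g)
    (hc : HasLocallyFiniteWalls c) (hq : form q q = 1) (hqy : form q y.1 = 0) :
    ∀ᶠ s in 𝓝 (0 : ℝ), potential g (geodesic hq hqy s) + potential g (geodesic hq hqy (-s)) =
      2 * Real.cosh s * potential g y + (1 / 2) * (|Real.sinh s| * bending c y q) := by
  have h := (tendsto_geodesic hq hqy).eventually (hg.eventually_potential_eq hc y)
  have hneg : Tendsto (fun s : ℝ => -s) (𝓝 0) (𝓝 0) := by simpa using tendsto_neg (0 : ℝ)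
  filter_upwards [h, hneg.eventually h] with s hs hs'
  rw [hs, hs', bending_geodesic, bending_geodesic, form_geodesic, form_geodesic,
    Real.cosh_neg, Real.sinh_neg, abs_neg, potential]
  ring

lemma IsPrimitive.potential_nonpos_of_forall_le (hg : IsPrimitive c g)
    (hc : HasLocallyFiniteWalls c) (hdisj : HasDisjointWalls c) (hd : 2 ≤ d)
    (hmax : ∀ z, potential g z ≤ potential g y) : potential g y ≤ 0 := by
  obtain ⟨q, hq, hqy, hqc⟩ := hdisj.exists_unit_tangent hd y
  obtain ⟨s, hs, h⟩ := (hg.eventually_potential_geodesic_add hc hq hqy).exists_gt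
  rw [bending_eq_zero hqc, mul_zero, mul_zero, add_zero] at h
  nlinarith [hmax (geodesic hq hqy s), hmax (geodesic hq hqy (-s)), Real.one_lt_cosh.2 hs.ne']

lemma IsPrimitive.bending_eq_zero_of_potential_eq_zero (hg : IsPrimitive c g)
    (hc : HasLocallyFiniteWalls c) (hzero : ∀ z, potential g z = 0) (hq : form q q = 1)
    (hqy : form q y.1 = 0) : bending c y q = 0 := by
  obtain ⟨s, hs, h⟩ := (hg.eventually_potential_geodesic_add hc hq hqy).exists_gt
  simpa [hzero, hs.ne'] using h

end Potential

section Action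

variable {Γ : Subgroup (OPlus d)} {c : Mink d → ℝ} {g : Hyp d → Mink d} {x y : Hyp d}
  {v w : Mink d}

lemma form_smul_apply (A : Γ) (y : Hyp d) (v : Mink d) :
    form (A • y).1 (A.1.1 v) = form y.1 v :=
  A.1.2.1 y.1 v

lemma smul_mem_hyperplane_iff (A : Γ) : A • y ∈ hyperplane (A.1.1 v) ↔ y ∈ hyperplane v := by
  rw [mem_hyperplane, form_smul_apply, mem_hyperplane]

lemma side_smul (A : Γ) (v : Mink d) (y : Hyp d) : side (A.1.1 v) (A • y) = side v y := by
  rw [side, form_smul_apply, side]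

lemma signedCrossing_smul (A : Γ) (hinv : ∀ v, c (A.1.1 v) = c v) (x y : Hyp d) :
    signedCrossing c (A • x) (A • y) = A.1.1 (signedCrossing c x y) := by
  rw [signedCrossing, signedCrossing, map_smul, ← finsum_comp_equiv A.1.1.toEquiv]
  congr 1
  refine Eq.trans ?_ (A.1.1.toAddEquiv.map_finsum _).symm
  simp [side_smul, hinv]

lemma HasLocallyFiniteWalls.signedCrossing_mul_smul (hc : HasLocallyFiniteWalls c)
    (hinv : ∀ (A : Γ) (v : Mink d), c (A.1.1 v) = c v) (x : Hyp d) (A B : Γ) :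
    signedCrossing c x ((A * B) • x) =
      A.1.1 (signedCrossing c x (B • x)) + signedCrossing c x (A • x) := by
  rw [← signedCrossing_smul A (hinv A), smul_smul]
  exact (hc.signedCrossing_add x (A • x) _).symm.trans (add_comm _ _)

lemma HasLocallyFiniteWalls.exists_equivariant_isPrimitive (hc : HasLocallyFiniteWalls c)
    (hinv : ∀ (A : Γ) (v : Mink d), c (A.1.1 v) = c v)
    (hw : ∀ A : Γ, signedCrossing c x (A • x) = A.1.1 w - w) :
    ∃ g, IsPrimitive c g ∧ ∀ (A : Γ) y, g (A • y) = A.1.1 (g y) := by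
  refine ⟨fun y => w + signedCrossing c x y, fun y z => ?_, fun A y => ?_⟩
  · rw [add_assoc, hc.signedCrossing_add]
  · beta_reduce
    rw [← hc.signedCrossing_add x (A • x), hw, signedCrossing_smul A (hinv A), map_add]
    abel

lemma potential_smul (hequiv : ∀ (A : Γ) y, g (A • y) = A.1.1 (g y)) (A : Γ) (y : Hyp d) :
    potential g (A • y) = potential g y := by
  rw [potential, hequiv, form_smul_apply, potential]

lemma exists_forall_le_of_smul_invariant {G X α : Type*} [Group G] [MulAction G X]
    [TopologicalSpace X] [CompactSpace (Quotient (MulAction.orbitRel G X))] [Nonempty X]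
    [LinearOrder α] [TopologicalSpace α] [ClosedIciTopology α] {f : X → α} (hf : Continuous f)
    (hinv : ∀ (a : G) x, f (a • x) = f x) : ∃ x, ∀ y, f y ≤ f x := by
  have hlift : ∀ a b, MulAction.orbitRel G X a b → f a = f b := by
    rintro _ b ⟨a, rfl⟩
    exact hinv a b
  have : Nonempty (Quotient (MulAction.orbitRel G X)) := Nonempty.map (Quotient.mk _) ‹_›
  obtain ⟨m, -, hm⟩ := isCompact_univ.exists_isMaxOn Set.univ_nonempty
    (hf.quotient_lift hlift).continuousOn
  obtain ⟨x, rfl⟩ := Quotient.exists_rep m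
  exact ⟨x, fun y => hm (Set.mem_univ (Quotient.mk _ y))⟩

lemma IsPrimitive.potential_nonpos [CompactSpace (HypQuotient Γ)] (hg : IsPrimitive c g)
    (hequiv : ∀ (A : Γ) y, g (A • y) = A.1.1 (g y)) (hc : HasLocallyFiniteWalls c)
    (hdisj : HasDisjointWalls c) (hd : 2 ≤ d) (y : Hyp d) : potential g y ≤ 0 := by
  have : Nonempty (Hyp d) := ⟨y⟩
  obtain ⟨m, hm⟩ :=
    exists_forall_le_of_smul_invariant (hg.continuous_potential hc) (potential_smul hequiv)
  exact (hm y).trans (hg.potential_nonpos_of_forall_le hc hdisj hd hm)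

lemma IsPrimitive.potential_eq_zero [CompactSpace (HypQuotient Γ)] (hg : IsPrimitive c g)
    (hequiv : ∀ (A : Γ) y, g (A • y) = A.1.1 (g y)) (hc : HasLocallyFiniteWalls c)
    (hdisj : HasDisjointWalls c) (hd : 2 ≤ d) (y : Hyp d) : potential g y = 0 := by
  refine le_antisymm (hg.potential_nonpos hequiv hc hdisj hd y) ?_
  have hequiv' : ∀ (A : Γ) y, (-g) (A • y) = A.1.1 ((-g) y) := fun A y => by simp [hequiv]
  have h := hg.neg.potential_nonpos hequiv' hc.neg hdisj.neg hd y
  rwa [potential_neg, neg_nonpos] at h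

lemma weight_eq_zero_of_signedCrossing_eq_coboundary [CompactSpace (HypQuotient Γ)] (hd : 2 ≤ d)
    (hc : HasLocallyFiniteWalls c) (hdisj : HasDisjointWalls c) (heven : c.Even)
    (hinv : ∀ (A : Γ) (v : Mink d), c (A.1.1 v) = c v)
    (hw : ∀ A : Γ, signedCrossing c x (A • x) = A.1.1 w - w) (hv : form v v = 1)
    (hyv : y ∈ hyperplane v) : c v = 0 := by
  by_contra hcv
  obtain ⟨g, hg, hequiv⟩ := hc.exists_equivariant_isPrimitive hinv hw
  have hzero := hg.potential_eq_zero hequiv hc hdisj hd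
  have hbending := hg.bending_eq_zero_of_potential_eq_zero hc hzero hv ((form_comm _ _).trans hyv)
  rw [hdisj.bending_normal heven hv ⟨hcv, hyv⟩] at hbending
  exact hcv (by linarith)

end Action

section Hypersurfaces

variable {Γ : Subgroup (OPlus d)} {S : Set (HypQuotient Γ)} {x y : Hyp d} {u v : Mink d}

/-- The unit normals, in both orientations, of the lifts of `S`. -/
def liftNormals (Γ : Subgroup (OPlus d)) (S : Set (HypQuotient Γ)) : Set (Mink d) :=
  {v | form v v = 1 ∧ hyperplane v ⊆ proj Γ ⁻¹' S}

/-- The weight that is `1` on the lifts of `S`. -/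
noncomputable def liftWeight (Γ : Subgroup (OPlus d)) (S : Set (HypQuotient Γ)) : Mink d → ℝ :=
  (liftNormals Γ S).indicator 1

lemma continuous_proj : Continuous (proj Γ) := continuous_quotient_mk'

@[simp] lemma proj_smul (A : Γ) (y : Hyp d) : proj Γ (A • y) = proj Γ y :=
  Quotient.sound ⟨A, rfl⟩

@[simp] lemma neg_mem_liftNormals_iff : -v ∈ liftNormals Γ S ↔ v ∈ liftNormals Γ S := by
  simp [liftNormals, form_neg_left, form_neg_right]

lemma apply_mem_liftNormals_iff (A : Γ) : A.1.1 v ∈ liftNormals Γ S ↔ v ∈ liftNormals Γ S := by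
  refine and_congr (by rw [A.1.2.1]) ?_
  simp only [Set.subset_def, Set.mem_preimage]
  rw [(MulAction.surjective A).forall]
  simp only [smul_mem_hyperplane_iff, proj_smul]

lemma liftWeight_apply_of_mem (hv : v ∈ liftNormals Γ S) : liftWeight Γ S v = 1 :=
  Set.indicator_of_mem hv 1

lemma liftWeight_apply_of_notMem (hv : v ∉ liftNormals Γ S) : liftWeight Γ S v = 0 :=
  Set.indicator_of_notMem hv 1

lemma even_liftWeight : (liftWeight Γ S).Even := fun v => by
  classical
  simp [liftWeight, Set.indicator_apply]

lemma liftWeight_apply (A : Γ) (v : Mink d) : liftWeight Γ S (A.1.1 v) = liftWeight Γ S v := by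
  classical
  simp [liftWeight, Set.indicator_apply, apply_mem_liftNormals_iff A]

lemma crossedNormals_subset_liftNormals : crossedNormals Γ S x y ⊆ liftNormals Γ S :=
  fun _ hv => ⟨hv.1, hv.2.1⟩

lemma mem_crossedNormals_iff (hv : v ∈ liftNormals Γ S) :
    v ∈ crossedNormals Γ S x y ↔ form x.1 v < 0 ∧ 0 < form y.1 v :=
  ⟨fun h => h.2.2, fun h => ⟨hv.1, hv.2, h⟩⟩

lemma liftWeight_mul_side_sub_smul (hx : proj Γ x ∉ S) (hy : proj Γ y ∉ S) (v : Mink d) :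
    (liftWeight Γ S v * ((side v y : ℝ) - side v x)) • v =
      (2 : ℝ) • ((crossedNormals Γ S x y).indicator id v +
        (crossedNormals Γ S x y).indicator id (-v)) := by
  classical
  by_cases hv : v ∈ liftNormals Γ S
  · have hxv : form x.1 v ≠ 0 := fun h => hx (hv.2 h)
    have hyv : form y.1 v ≠ 0 := fun h => hy (hv.2 h)
    have hmem := mem_crossedNormals_iff (x := x) (y := y) hv
    have hmem_neg := mem_crossedNormals_iff (x := x) (y := y) (neg_mem_liftNormals_iff.2 hv)
    rw [form_neg_right, form_neg_right, neg_lt_zero, neg_pos] at hmem_neg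
    rw [liftWeight_apply_of_mem hv, one_mul, side, side, Set.indicator_apply, Set.indicator_apply]
    rcases hxv.lt_or_gt with hxv | hxv <;> rcases hyv.lt_or_gt with hyv | hyv <;>
      norm_num [hmem, hmem_neg, hxv, hyv, hxv.not_gt, hyv.not_gt, neg_smul]
  · have hv' : v ∉ crossedNormals Γ S x y := fun h => hv (crossedNormals_subset_liftNormals h)
    have hv_neg : -v ∉ crossedNormals Γ S x y := fun h =>
      hv (neg_mem_liftNormals_iff.1 (crossedNormals_subset_liftNormals h))
    simp [liftWeight_apply_of_notMem hv, hv', hv_neg]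

namespace IsTotallyGeodesicHypersurface

protected lemma iUnion {ι : Type*} [Finite ι] [Nonempty ι] {H : ι → Set (HypQuotient Γ)}
    (hH : ∀ i, IsTotallyGeodesicHypersurface Γ (H i)) (hdisj : Pairwise (Disjoint on H)) :
    IsTotallyGeodesicHypersurface Γ (⋃ i, H i) where
  nonempty := Set.nonempty_iUnion.2 ⟨Classical.arbitrary ι, (hH _).nonempty⟩
  isClosed := isClosed_iUnion_of_finite fun i => (hH i).isClosed
  locally_hyperplane y hy := by
    obtain ⟨i, hi⟩ := Set.mem_iUnion.1 hy
    obtain ⟨v, hv, U, hU, hyU, h⟩ := (hH i).locally_hyperplane y hi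
    have hV : IsClosed (⋃ j : {j // j ≠ i}, proj Γ ⁻¹' H j) :=
      isClosed_iUnion_of_finite fun j => (hH j).isClosed.preimage continuous_proj
    refine ⟨v, hv, U ∩ (⋃ j : {j // j ≠ i}, proj Γ ⁻¹' H j)ᶜ, hU.inter hV.isOpen_compl,
      ⟨hyU, ?_⟩, ?_⟩
    · simp only [Set.mem_compl_iff, Set.mem_iUnion, not_exists]
      exact fun j hj => Set.disjoint_left.1 (hdisj j.2) hj hi
    · ext z
      have hz := Set.ext_iff.1 h z
      simp only [Set.mem_inter_iff, Set.mem_preimage, Set.mem_iUnion, Set.mem_compl_iff,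
        not_exists, Subtype.forall] at hz ⊢
      constructor
      · rintro ⟨⟨j, hj⟩, hzU, hzj⟩
        obtain rfl : j = i := by_contra fun hji => hzj j hji hj
        exact ⟨(hz.1 ⟨hj, hzU⟩).1, hzU, hzj⟩
      · rintro ⟨hzv, hzU, hzj⟩
        exact ⟨⟨i, (hz.2 ⟨hzv, hzU⟩).1⟩, hzU, hzj⟩

variable (hS : IsTotallyGeodesicHypersurface Γ S)

include hS

lemma isClosed_preimage : IsClosed (proj Γ ⁻¹' S) := hS.isClosed.preimage continuous_proj

lemma exists_eventually_mem_iff (hy : proj Γ y ∈ S) :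
    ∃ v, form v v = 1 ∧ ∀ᶠ z in 𝓝 y, proj Γ z ∈ S ↔ z ∈ hyperplane v := by
  obtain ⟨v, hv, U, hU, hyU, h⟩ := hS.locally_hyperplane y hy
  refine ⟨v, hv, ?_⟩
  filter_upwards [hU.mem_nhds hyU] with z hz
  have hz' := Set.ext_iff.1 h z
  simpa [hz] using hz'

lemma eventually_subset_iff (hv : form v v = 1) (hyv : y ∈ hyperplane v) :
    ∀ᶠ z in 𝓝 y, z ∈ hyperplane v → ((∀ᶠ z' in 𝓝 y, z' ∈ hyperplane v → proj Γ z' ∈ S) ↔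
      ∀ᶠ z' in 𝓝 z, z' ∈ hyperplane v → proj Γ z' ∈ S) := by
  by_cases hy : proj Γ y ∈ S
  · obtain ⟨u, hu, h⟩ := hS.exists_eventually_mem_iff hy
    have hspread : ∀ᶠ z in 𝓝 y, (∀ᶠ z' in 𝓝 y, z' ∈ hyperplane v → proj Γ z' ∈ S) →
        ∀ᶠ z' in 𝓝 z, z' ∈ hyperplane v → proj Γ z' ∈ S :=
      eventually_imp_distrib_left.2 eventually_eventually_nhds.2
    filter_upwards [eventually_eventually_nhds.2 h, hspread] with z hz hyz hzv
    refine ⟨hyz, fun hgood => ?_⟩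
    have hzu : ∀ᶠ z' in 𝓝 z, z' ∈ hyperplane v → z' ∈ hyperplane u := by
      filter_upwards [hz, hgood] with z' hz' hgood' hz'v using hz'.1 (hgood' hz'v)
    have huv : hyperplane u = hyperplane v := by
      rcases eq_or_eq_neg_of_eventually_mem_hyperplane hu hv hzv hzu with rfl | rfl
      · rfl
      · exact hyperplane_neg v
    filter_upwards [h] with z' hz' hz'v
    exact hz'.2 (huv ▸ hz'v)
  · filter_upwards [hS.isClosed_preimage.isOpen_compl.mem_nhds hy] with z hz hzv
    exact iff_of_false (fun h => hy (h.self_of_nhds hyv)) fun h => hz (h.self_of_nhds hzv)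

lemma hyperplane_subset (hv : form v v = 1) (hyv : y ∈ hyperplane v)
    (h : ∀ᶠ z in 𝓝 y, z ∈ hyperplane v → proj Γ z ∈ S) : hyperplane v ⊆ proj Γ ⁻¹' S := by
  intro z hzv
  have hyz := (isPreconnected_hyperplane v).induction₂
    (fun a b => (∀ᶠ z in 𝓝 a, z ∈ hyperplane v → proj Γ z ∈ S) ↔
      ∀ᶠ z in 𝓝 b, z ∈ hyperplane v → proj Γ z ∈ S)
    (fun a ha => eventually_nhdsWithin_iff.2 (hS.eventually_subset_iff hv ha))
    (fun _ _ _ _ _ _ => Iff.trans) (fun _ _ _ _ => Iff.symm) hyv hzv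
  exact (hyz.1 h).self_of_nhds hzv

lemma exists_mem_liftNormals (hy : proj Γ y ∈ S) :
    ∃ v ∈ liftNormals Γ S, y ∈ hyperplane v ∧ ∀ᶠ z in 𝓝 y, proj Γ z ∈ S ↔ z ∈ hyperplane v := by
  obtain ⟨v, hv, h⟩ := hS.exists_eventually_mem_iff hy
  have hyv : y ∈ hyperplane v := h.self_of_nhds.1 hy
  exact ⟨v, ⟨hv, hS.hyperplane_subset hv hyv (h.mono fun _ => Iff.mpr)⟩, hyv, h⟩

lemma eq_or_eq_neg_of_mem_hyperplane (hu : u ∈ liftNormals Γ S) (hv : v ∈ liftNormals Γ S)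
    (hyu : y ∈ hyperplane u) (hyv : y ∈ hyperplane v) : u = v ∨ u = -v := by
  obtain ⟨w, hw, -, h⟩ := hS.exists_mem_liftNormals (hu.2 hyu)
  have key : ∀ u ∈ liftNormals Γ S, y ∈ hyperplane u → w = u ∨ w = -u := fun u hu hyu =>
    eq_or_eq_neg_of_eventually_mem_hyperplane hw.1 hu.1 hyu (h.mono fun z hz hzu => hz.1 (hu.2 hzu))
  rcases key u hu hyu with rfl | rfl
  · exact key v hv hyv
  · simpa only [neg_eq_iff_eq_neg, neg_neg, or_comm] using key v hv hyv

lemma hasDisjointWalls {c : Mink d → ℝ} (h : support c ⊆ liftNormals Γ S) : HasDisjointWalls c :=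
  fun _ hu _ hv _ hyu hyv => hS.eq_or_eq_neg_of_mem_hyperplane (h hu) (h hv) hyu hyv

lemma hasLocallyFiniteWalls {c : Mink d → ℝ} (h : support c ⊆ liftNormals Γ S) :
    HasLocallyFiniteWalls c := by
  intro y
  by_cases hy : proj Γ y ∈ S
  · obtain ⟨v, hv, -, hnear⟩ := hS.exists_mem_liftNormals hy
    refine ⟨_, hnear, ((Set.toFinite {v, -v}).preimage Subtype.val_injective.injOn).subset ?_⟩
    rintro u ⟨z, hzu, hz⟩
    exact hS.eq_or_eq_neg_of_mem_hyperplane (h u.2) hv hzu (hz.1 ((h u.2).2 hzu))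
  · refine ⟨_, hS.isClosed_preimage.isOpen_compl.mem_nhds hy, Set.finite_empty.subset ?_⟩
    rintro u ⟨z, hzu, hz⟩
    exact hz ((h u.2).2 hzu)

lemma hasLocallyFiniteWalls_liftWeight : HasLocallyFiniteWalls (liftWeight Γ S) :=
  hS.hasLocallyFiniteWalls Set.support_indicator_subset

lemma finite_crossedNormals (x y : Hyp d) : (crossedNormals Γ S x y).Finite := by
  refine (hS.hasLocallyFiniteWalls_liftWeight.finite_side_ne x y).subset fun v hv => ⟨?_, ?_⟩
  · rw [mem_support, liftWeight_apply_of_mem (crossedNormals_subset_liftNormals hv)]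
    exact one_ne_zero
  · rw [side, side, sign_neg hv.2.2.1, sign_pos hv.2.2.2]
    decide

lemma signedCrossing_liftWeight (hx : proj Γ x ∉ S) (hy : proj Γ y ∉ S) :
    signedCrossing (liftWeight Γ S) x y = crossing Γ S x y := by
  set C := crossedNormals Γ S x y with hC
  have hfin : HasFiniteSupport (C.indicator id) :=
    (hS.finite_crossedNormals x y).subset Set.support_indicator_subset
  have hfin_neg : HasFiniteSupport fun v => C.indicator id (-v) :=
    hfin.preimage neg_injective.injOn
  have hsum : ∑ᶠ v, C.indicator id v = crossing Γ S x y := (finsum_mem_def C id).symm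
  have hsum_neg : ∑ᶠ v, C.indicator id (-v) = crossing Γ S x y :=
    (finsum_comp_equiv (Equiv.neg (Mink d))).trans hsum
  rw [signedCrossing]
  simp only [liftWeight_mul_side_sub_smul hx hy, ← hC]
  rw [← smul_finsum, finsum_add_distrib hfin hfin_neg, hsum, hsum_neg, ← two_smul ℝ, smul_smul,
    smul_smul]
  norm_num

lemma exists_proj_notMem : ∃ x : Hyp d, proj Γ x ∉ S := by
  obtain ⟨s, hs⟩ := hS.nonempty
  obtain ⟨y, rfl⟩ := Quotient.exists_rep s
  obtain ⟨v, hv, hyv, h⟩ := hS.exists_mem_liftNormals hs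
  have hvy : form v y.1 = 0 := (form_comm _ _).trans hyv
  obtain ⟨s, hs, hsv⟩ := ((tendsto_geodesic hv.1 hvy).eventually h).exists_gt
  refine ⟨geodesic hv.1 hvy s, fun hmem => ?_⟩
  have := mem_hyperplane.1 (hsv.1 hmem)
  rw [form_geodesic_of_mem_hyperplane hv.1 hvy s hyv, hv.1, mul_one, Real.sinh_eq_zero] at this
  exact hs.ne' this

end IsTotallyGeodesicHypersurface

end Hypersurfaces

section Cocycles

variable {Γ : Subgroup (OPlus d)} {S : Set (HypQuotient Γ)} {ι : Type*} [Fintype ι]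
  {H : ι → Set (HypQuotient Γ)} {x y : Hyp d} {w v : Mink d}

/-- The weight that is `ω i` on the lifts of `H i`. -/
noncomputable def totalWeight (H : ι → Set (HypQuotient Γ)) (ω : ι → ℝ) : Mink d → ℝ :=
  ∑ i, ω i • liftWeight Γ (H i)

lemma totalWeight_apply (ω : ι → ℝ) (v : Mink d) :
    totalWeight H ω v = ∑ i, ω i * liftWeight Γ (H i) v := by
  simp [totalWeight]

lemma even_totalWeight (ω : ι → ℝ) : (totalWeight H ω).Even := fun v => by
  simp only [totalWeight_apply, even_liftWeight v]

lemma totalWeight_smul_apply (ω : ι → ℝ) (A : Γ) (v : Mink d) :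
    totalWeight H ω (A.1.1 v) = totalWeight H ω v := by
  simp only [totalWeight_apply, liftWeight_apply]

lemma support_totalWeight_subset (ω : ι → ℝ) :
    support (totalWeight H ω) ⊆ liftNormals Γ (⋃ i, H i) := by
  intro v hv
  rw [mem_support, totalWeight_apply] at hv
  obtain ⟨i, -, hi⟩ := Finset.exists_ne_zero_of_sum_ne_zero hv
  have hvi : v ∈ liftNormals Γ (H i) :=
    by_contra fun h => hi (by rw [liftWeight_apply_of_notMem h, mul_zero])
  exact ⟨hvi.1, hvi.2.trans (Set.preimage_mono (Set.subset_iUnion H i))⟩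

lemma totalWeight_apply_of_mem (hdisj : Pairwise (Disjoint on H)) (ω : ι → ℝ) {i : ι}
    (hv : v ∈ liftNormals Γ (H i)) (hyv : y ∈ hyperplane v) : totalWeight H ω v = ω i := by
  rw [totalWeight_apply, Finset.sum_eq_single i, liftWeight_apply_of_mem hv, mul_one]
  · intro j _ hji
    have hvj : v ∉ liftNormals Γ (H j) := fun h =>
      Set.disjoint_left.1 (hdisj hji) (h.2 hyv) (hv.2 hyv)
    rw [liftWeight_apply_of_notMem hvj, mul_zero]
  · exact fun hi => absurd (Finset.mem_univ i) hi

lemma signedCrossing_totalWeight (hH : ∀ i, IsTotallyGeodesicHypersurface Γ (H i))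
    (hx : ∀ i, proj Γ x ∉ H i) (hy : ∀ i, proj Γ y ∉ H i) (ω : ι → ℝ) :
    signedCrossing (totalWeight H ω) x y = ∑ i, ω i • crossing Γ (H i) x y := by
  rw [totalWeight, signedCrossing_sum_smul _ _ fun i _ => (hH i).hasLocallyFiniteWalls_liftWeight]
  simp only [(hH _).signedCrossing_liftWeight (hx _) (hy _)]

/-- The cocycle `A ↦ crossing Γ S x (A • x)`. -/
noncomputable def crossingCocycle (hS : IsTotallyGeodesicHypersurface Γ S)
    (hx : proj Γ x ∉ S) : groupCohomology.cocycles₁ (minkRep Γ) :=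
  ⟨fun A => crossing Γ S x (A • x), (groupCohomology.mem_cocycles₁_iff _).2 fun A B => by
    have hx' : ∀ A : Γ, proj Γ (A • x) ∉ S := fun A => by rwa [proj_smul]
    simp only [← hS.signedCrossing_liftWeight hx (hx' _)]
    exact hS.hasLocallyFiniteWalls_liftWeight.signedCrossing_mul_smul liftWeight_apply x A B⟩

/-- The weighted sum of the cocycles `crossingCocycle`, as a linear function of the weights. -/
noncomputable def weightedCocycle (hH : ∀ i, IsTotallyGeodesicHypersurface Γ (H i))
    (hx : ∀ i, proj Γ x ∉ H i) : (ι → ℝ) →ₗ[ℝ] groupCohomology.cocycles₁ (minkRep Γ) :=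
  Fintype.linearCombination ℝ fun i => crossingCocycle (hH i) (hx i)

lemma weightedCocycle_apply (hH : ∀ i, IsTotallyGeodesicHypersurface Γ (H i))
    (hx : ∀ i, proj Γ x ∉ H i) (ω : ι → ℝ) (A : Γ) :
    (weightedCocycle hH hx ω : Γ → Mink d) A = ∑ i, ω i • crossing Γ (H i) x (A • x) := by
  have h := map_sum (groupCohomology.cocycles₁ (minkRep Γ)).subtype
    (fun i => ω i • crossingCocycle (hH i) (hx i)) Finset.univ
  exact (congrFun h A).trans (Finset.sum_apply A _ _)

lemma weights_eq_zero_of_sum_crossing_eq_coboundary (hd : 2 ≤ d) [CompactSpace (HypQuotient Γ)]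
    (hH : ∀ i, IsTotallyGeodesicHypersurface Γ (H i)) (hdisj : Pairwise (Disjoint on H))
    (hx : ∀ i, proj Γ x ∉ H i) {ω : ι → ℝ}
    (hw : ∀ A : Γ, ∑ i, ω i • crossing Γ (H i) x (A • x) = A.1.1 w - w) : ω = 0 := by
  funext i
  have : Nonempty ι := ⟨i⟩
  have hunion := IsTotallyGeodesicHypersurface.iUnion hH hdisj
  have hsupport := support_totalWeight_subset (H := H) ω
  obtain ⟨s, hs⟩ := (hH i).nonempty
  obtain ⟨y, rfl⟩ := Quotient.exists_rep s
  obtain ⟨v, hv, hyv, -⟩ := (hH i).exists_mem_liftNormals hs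
  rw [Pi.zero_apply, ← totalWeight_apply_of_mem hdisj ω hv hyv]
  refine weight_eq_zero_of_signedCrossing_eq_coboundary hd (hunion.hasLocallyFiniteWalls hsupport)
    (hunion.hasDisjointWalls hsupport) (even_totalWeight ω) (totalWeight_smul_apply ω)
    (x := x) (w := w) (fun A => ?_) hv.1 hyv
  rw [signedCrossing_totalWeight hH hx (fun i => by rw [proj_smul]; exact hx i), hw]

lemma injective_H1π_comp_weightedCocycle (hd : 2 ≤ d) [CompactSpace (HypQuotient Γ)]
    (hH : ∀ i, IsTotallyGeodesicHypersurface Γ (H i)) (hdisj : Pairwise (Disjoint on H))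
    (hx : ∀ i, proj Γ x ∉ H i) :
    Injective ((groupCohomology.H1π (minkRep Γ)).hom ∘ₗ weightedCocycle hH hx) := by
  refine (injective_iff_map_eq_zero _).2 fun ω hω => ?_
  obtain ⟨w, hw⟩ := (groupCohomology.H1π_eq_zero_iff _).1 hω
  refine weights_eq_zero_of_sum_crossing_eq_coboundary hd hH hdisj hx (w := w) fun A => ?_
  rw [← weightedCocycle_apply hH hx]
  exact (congrFun hw A).symm

lemma card_le_rank_H1 (hd : 2 ≤ d) [CompactSpace (HypQuotient Γ)]
    (hH : ∀ i, IsTotallyGeodesicHypersurface Γ (H i)) (hdisj : Pairwise (Disjoint on H)) :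
    (Fintype.card ι : Cardinal) ≤ Module.rank ℝ (groupCohomology.H1 (minkRep Γ)) := by
  cases isEmpty_or_nonempty ι
  · simp
  obtain ⟨x, hx⟩ := (IsTotallyGeodesicHypersurface.iUnion hH hdisj).exists_proj_notMem
  have hx' : ∀ i, proj Γ x ∉ H i := fun i hi => hx (Set.mem_iUnion_of_mem i hi)
  simpa using LinearMap.lift_rank_le_of_injective _
    (injective_H1π_comp_weightedCocycle hd hH hdisj hx')

end Cocycles

end HypCocycle

open HypCocycle in
theorem mainTheorem9_general {d : ℕ} (hd : 2 ≤ d) {Γ : Subgroup (OPlus d)}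
    [CompactSpace (HypQuotient Γ)] {ι : Type*} [Fintype ι] {H : ι → Set (HypQuotient Γ)}
    (hH : ∀ i, IsTotallyGeodesicHypersurface Γ (H i))
    (hdisj : Pairwise (Function.onFun Disjoint H)) :
    (Fintype.card ι : Cardinal) ≤ Module.rank ℝ (groupCohomology.H1 (minkRep Γ)) ∧
    ∀ x : Hyp d, (∀ i, proj Γ x ∉ H i) →
      ∃ τ : (ι → ℝ) →ₗ[ℝ] groupCohomology.cocycles₁ (minkRep Γ),
        (∀ (ω : ι → ℝ) (A : Γ),
          (τ ω : Γ → Mink d) A = ∑ i, ω i • crossing Γ (H i) x (A • x)) ∧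
        Function.Injective fun ω : ι → ℝ => groupCohomology.H1π (minkRep Γ) (τ ω) :=
  ⟨card_le_rank_H1 hd hH hdisj, fun _ hx => ⟨weightedCocycle hH hx, weightedCocycle_apply hH hx,
    injective_H1π_comp_weightedCocycle hd hH hdisj hx⟩⟩

theorem mainTheorem9 (d : ℕ) (hd : 2 ≤ d)
    (Γ : Subgroup (HypCocycle.OPlus d)) (hΓ : HypCocycle.IsCompactHyperbolicManifold Γ)
    (n : ℕ) (H : Fin n → Set (HypCocycle.HypQuotient Γ))
    (hH : ∀ i, HypCocycle.IsTotallyGeodesicHypersurface Γ (H i))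
    (hdisj : ∀ i j, i ≠ j → Disjoint (H i) (H j)) :
    (n : Cardinal) ≤ Module.rank ℝ (groupCohomology.H1 (HypCocycle.minkRep Γ)) ∧
    ∀ x : HypCocycle.Hyp d, (∀ i, HypCocycle.proj Γ x ∉ H i) →
      ∃ τ : (Fin n → ℝ) →ₗ[ℝ] groupCohomology.cocycles₁ (HypCocycle.minkRep Γ),
        (∀ (ω : Fin n → ℝ) (A : Γ),
          (τ ω : Γ → HypCocycle.Mink d) A =
            ∑ i, ω i • HypCocycle.crossing Γ (H i) x (A • x)) ∧
        Function.Injective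
          (fun ω : Fin n → ℝ => groupCohomology.H1π (HypCocycle.minkRep Γ) (τ ω)) := by
  have := hΓ.compact
  simpa only [Fintype.card_fin] using mainTheorem9_general hd hH fun _ _ => hdisj _ _
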